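/- Fix integers $N, M\ge 0$. A relay network consists of independent complex random variables $G^{(n,m)}\sim CN(\overline G^{(n,m)},\sigma_G^2)$, $F^{(m)}\sim CN(\overline F^{(m)},\sigma_F^2)$, $V^{(m)}\sim CN(0,\sigma_V^2)$, $W^{(n)}\sim CN(0,\sigma_W^2)$ ($1\le n\le N$, $1\le m\le M$) with $\sigma_G,\sigma_F,\sigma_W>0$ and $\sigma_V\ge 0$, where $CN(\mu,\sigma^2)$ is the circularly symmetric complex normal law with mean $\mu$ and $E|Z-\mu|^2=\sigma^2$. The relay signals are $R^{(m)}=V^{(m)}$ under $\mathcal H_0$ and $R^{(m)}=F^{(m)}+V^{(m)}$ under $\mathcal H_1$, with mean and variance $\overline R^{(m)}=0$, $\sigma_R^2=\sigma_V^2$ under $\mathcal H_0$ and $\overline R^{(m)}=\overline F^{(m)}$, $\sigma_R^2=\sigma_F^2+\sigma_V^2$ under $\mathcal H_1$. The received components are $$Y^{(n)}=\sum_{m=1}^M G^{(n,m)}R^{(m)}+W^{(n)} .$$ Let $\mu_n=E\,Y^{(n)}$, $s_n^2=E|Y^{(n)}-\mu_n|^2$ and $\widetilde Y^{(n)}=(Y^{(n)}-\mu_n)/s_n$.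 Consider a sequence of such networks ($N$, $M$ and the hypothesis $\mathcal H_0$ or $\mathcal H_1$ are fixed; all means and variances may vary along the sequence). Say that component $n$ has diverging line of sight if at least one of the following holds: * $|\overline G^{(n,m)}|/\sigma_G\to\infty$ for some $m$; * $|\overline R^{(m)}|/\sigma_R\to\infty$ for some $m$ (this can happen only under $\mathcal H_1$); * the hypothesis is $\mathcal H_1$, $|\overline F^{(m)}|/\sigma_F\to\infty$ for some $m$, and $\sigma_V/\sigma_F$ stays bounded (for example, $\sigma_F$ and $\sigma_V$ are fixed). Then: 1. $Y^{(n)}$ is always square integrable with $s_n^2>0$, and if component $n$ has diverging line of sight, then $\widetilde Y^{(n)}$ converges in distribution to $CN(0,1)$; that is, $Y^{(n)}$ is asymptotically $CN(\mu_n,s_n^2)$. 2. If every component has diverging line of sight, then the vector $Y$ is asymptotically multivariate complex normal: with $\Gamma$ the covariance matrix of $(\widetilde Y^{(1)},\dots,\widetilde Y^{(N)})$, for every bounded continuous $f:\mathbb C^N\to\mathbb R$ the difference $E f(\widetilde Y^{(1)},\dots,\widetilde Y^{(N)})-\int f\,dCN(0,\Gamma)$ tends to $0$ along the sequence. 3.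 Let $X\sim N(\overline X,\sigma_X^2)$ and $Y\sim N(\overline Y,\sigma_Y^2)$ be independent real normals with $\sigma_X,\sigma_Y>0$, $Z=XY/(\sigma_X\sigma_Y)$ and $\widetilde Z=(Z-EZ)/\sqrt{\operatorname{Var} Z}$. Along every sequence of parameters with $|\overline X|/\sigma_X\to\infty$ or $|\overline Y|/\sigma_Y\to\infty$, and for every $t\in\mathbb R$, $E\,e^{t\widetilde Z}$ is eventually finite and tends to $e^{t^2/2}$. -/

import Mathlib

open MeasureTheory ProbabilityTheory Filter Topology
open scoped NNReal ComplexConjugate BoundedContinuousFunction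

noncomputable section

/-- The circularly symmetric complex normal law `CN(m, v)` on `ℂ`: real and imaginary parts are
independent real normals with means `m.re`, `m.im` and variance `v / 2` each, so that
`E|Z - m|² = v`. -/
def complexNormal (m : ℂ) (v : ℝ≥0) : Measure ℂ :=
  ((gaussianReal m.re (v / 2)).prod (gaussianReal m.im (v / 2))).map
    (fun p : ℝ × ℝ => (⟨p.1, p.2⟩ : ℂ))

instance complexNormal_isProbabilityMeasure (m : ℂ) (v : ℝ≥0) :
    IsProbabilityMeasure (complexNormal m v) := by
  refine Measure.isProbabilityMeasure_map ?_
  exact Complex.measurableEquivRealProd.symm.measurable.aemeasurable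

/-- `ν` is the circularly symmetric multivariate complex normal law `CN(m, C)` on `ℂᴺ`: the law of
`m + A ζ`, where `ζ` has independent `CN(0, 1)` coordinates and `A Aᴴ = C`. (`C` is then positive
semidefinite, possibly singular, and `ν` does not depend on the choice of `A`.) -/
def IsComplexNormalVector {N : ℕ} (ν : Measure (Fin N → ℂ)) (m : Fin N → ℂ)
    (C : Matrix (Fin N) (Fin N) ℂ) : Prop :=
  ∃ A : Matrix (Fin N) (Fin N) ℂ, A * A.conjTranspose = C ∧
    ν = (Measure.pi fun _ : Fin N => complexNormal 0 1).map (fun ζ => m + A.mulVec ζ)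

/-- The two hypotheses: the primary base station is idle (`H0`) or active (`H1`). -/
inductive Hypothesis
  | H0
  | H1

/-- The amplify-and-forward network with `M` relays and `N` receive components in one symbol
period, on a probability space `(Ω, P)`. The standard deviations are `σG`, `σF`, `σV`, `σW`. -/
structure RelayNetwork (N M : ℕ) {Ω : Type*} [MeasurableSpace Ω] (P : Measure Ω) where
  /-- mean (channel estimate) of the relay-to-receiver channels -/
  Gbar : Fin N → Fin M → ℂ
  /-- mean (channel estimate) of the base-station-to-relay channels -/
  Fbar : Fin M → ℂ
  σG : ℝ≥0
  σF : ℝ≥0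
  σV : ℝ≥0
  σW : ℝ≥0
  σG_pos : 0 < σG
  σF_pos : 0 < σF
  σW_pos : 0 < σW
  /-- relay-to-receiver channels -/
  G : Fin N → Fin M → Ω → ℂ
  /-- base-station-to-relay channels -/
  F : Fin M → Ω → ℂ
  /-- noise at the relays -/
  V : Fin M → Ω → ℂ
  /-- noise at the receiver -/
  W : Fin N → Ω → ℂ
  law_G : ∀ n m, HasLaw (G n m) (complexNormal (Gbar n m) (σG ^ 2)) P
  law_F : ∀ m, HasLaw (F m) (complexNormal (Fbar m) (σF ^ 2)) P
  law_V : ∀ m, HasLaw (V m) (complexNormal 0 (σV ^ 2)) P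
  law_W : ∀ n, HasLaw (W n) (complexNormal 0 (σW ^ 2)) P
  /-- all the entries of `G`, `F`, `V`, `W` are mutually independent -/
  indep : iIndepFun (fun i : (Fin N × Fin M) ⊕ Fin M ⊕ Fin M ⊕ Fin N =>
    Sum.elim (fun j => G j.1 j.2) (Sum.elim F (Sum.elim V W)) i) P

namespace RelayNetwork

variable {N M : ℕ} {Ω : Type*} [MeasurableSpace Ω] {P : Measure Ω} (S : RelayNetwork N M P)

/-- The signal at (and retransmitted by) relay `m`: noise only under `H0`, and `F + V` under `H1`
(the pilot symbol is `1`). -/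
def R : Hypothesis → Fin M → Ω → ℂ
  | .H0, m => S.V m
  | .H1, m => fun ω => S.F m ω + S.V m ω

/-- The mean of the relay signal `R h m`. -/
def Rbar : Hypothesis → Fin M → ℂ
  | .H0, _ => 0
  | .H1, m => S.Fbar m

/-- The standard deviation of the relay signals under `h`. -/
def σR : Hypothesis → ℝ≥0
  | .H0 => S.σV
  | .H1 => NNReal.sqrt (S.σF ^ 2 + S.σV ^ 2)

/-- Line-of-sight ratio `|Ḡ| / σG` of the channel from relay `m` to component `n`. -/
def ρG (n : Fin N) (m : Fin M) : ℝ := ‖S.Gbar n m‖ / S.σG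

/-- Line-of-sight ratio `|F̄| / σF` of the channel from the base station to relay `m`. -/
def ρF (m : Fin M) : ℝ := ‖S.Fbar m‖ / S.σF

/-- Line-of-sight ratio `|R̄| / σR` of the signal of relay `m`. -/
def ρR (h : Hypothesis) (m : Fin M) : ℝ := ‖S.Rbar h m‖ / S.σR h

/-- The received component `Y⁽ⁿ⁾ = ∑ₘ G⁽ⁿᵐ⁾ R⁽ᵐ⁾ + W⁽ⁿ⁾`. -/
def Y (h : Hypothesis) (n : Fin N) (ω : Ω) : ℂ :=
  ∑ m, S.G n m ω * S.R h m ω + S.W n ω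

/-- The mean of `Y⁽ⁿ⁾`. -/
def meanY (h : Hypothesis) (n : Fin N) : ℂ := ∫ ω, S.Y h n ω ∂P

/-- The variance `E|Y⁽ⁿ⁾ - E Y⁽ⁿ⁾|²`. -/
def varY (h : Hypothesis) (n : Fin N) : ℝ := ∫ ω, ‖S.Y h n ω - S.meanY h n‖ ^ 2 ∂P

/-- The standardized component `(Y⁽ⁿ⁾ - E Y⁽ⁿ⁾) / √Var Y⁽ⁿ⁾`. -/
def stdY (h : Hypothesis) (n : Fin N) (ω : Ω) : ℂ :=
  (S.Y h n ω - S.meanY h n) / (Real.sqrt (S.varY h n) : ℂ)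

/-- The correlation matrix of the components, i.e. the covariance matrix of the standardized
components. -/
def corrY (h : Hypothesis) : Matrix (Fin N) (Fin N) ℂ :=
  Matrix.of fun n n' => ∫ ω, S.stdY h n ω * conj (S.stdY h n' ω) ∂P

end RelayNetwork

/-- Strong line of sight for component `n` along a sequence of networks, under hypothesis `h`: for
some `m` the line-of-sight ratio of one of the two factors of `G⁽ⁿᵐ⁾ R⁽ᵐ⁾` tends to infinity. The
last alternative gives, for `R = F + V`, the form in terms of the ratio of `F`. -/
def LineOfSightDiverges {N M : ℕ} {Ω : ℕ → Type*} [∀ k, MeasurableSpace (Ω k)]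
    {P : ∀ k, Measure (Ω k)} (S : ∀ k, RelayNetwork N M (P k)) (h : Hypothesis) (n : Fin N) :
    Prop :=
  (∃ m, Tendsto (fun k => (S k).ρG n m) atTop atTop) ∨
  (∃ m, Tendsto (fun k => (S k).ρR h m) atTop atTop) ∨
  (h = Hypothesis.H1 ∧ (∃ m, Tendsto (fun k => (S k).ρF m) atTop atTop) ∧
    ∃ c : ℝ≥0, ∀ k, (S k).σV ≤ c * (S k).σF)

/-- The standardization `(Z - E Z) / √Var Z` of the normalized product `Z = X Y / (σX σY)`. -/
def stdProduct {Ω : Type*} [MeasurableSpace Ω] (P : Measure Ω) (X Y : Ω → ℝ) (σX σY : ℝ≥0)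
    (ω : Ω) : ℝ :=
  (X ω * Y ω / (σX * σY) - ∫ ω', X ω' * Y ω' / (σX * σY) ∂P) /
    Real.sqrt (Var[fun ω' => X ω' * Y ω' / (σX * σY); P])

end

/-! Write every source as mean plus standard deviation times a standard complex normal. Then Y⁽ⁿ⁾
minus its mean is a linear combination of the channel variables ζ, the signal and noise variables η,
and the mixed products ζη. The ζ and η are independent, so these functions form an orthonormal
system in L². Hence the variance is the sum of the squared moduli of the coefficients (`rowSq`), and
the correlation matrix is T Tᴴ, with T the matrix of standardized coefficients (`corrY_eq`).

Only the products are not Gaussian. Their coefficients are at most σG σR in modulus, while a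
line-of-sight ratio r forces the variance to be at least r² σG² σR² (`exists_ratio`). So the product
entries of T are at most 1/r and vanish in the limit. Replace the products by fresh independent
standard normals: the result is exactly CN(0, T Tᴴ), and the error tends to 0 pointwise because all
entries of T are bounded by 1. Dominated convergence finishes the vector statement
(`tendsto_integral_chaosSum_sub`); the case of one component, where T Tᴴ = 1, gives convergence in
distribution.

For the real product, with a and b the two ratios of mean to deviation, two Gaussian integrations
give the moment generating function of the centred product in closed form for θ² < 1. At θ = t /
√(a² + b² + 1) its limit is read off. -/

section ComplexNormal

/-! ### The complex normal law: affine images, moments, characteristic function -/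

lemma measurable_complex_mk : Measurable (fun p : ℝ × ℝ => (⟨p.1, p.2⟩ : ℂ)) :=
  Complex.measurableEquivRealProd.symm.measurable

/-- Moves all parameters into an affine map of one fixed law. The degenerate case σ = 0 is included,
since the relay noise may vanish. -/
lemma complexNormal_eq_map (m : ℂ) (σ : ℝ≥0) :
    complexNormal m (σ ^ 2) = (complexNormal 0 1).map (fun z => m + (σ : ℂ) * z) := by
  have key (a : ℝ) : gaussianReal a (σ ^ 2 / 2) =
      (gaussianReal 0 (1 / 2)).map (fun x => a + σ * x) := by
    have h := (HasLaw.id (μ := gaussianReal 0 (1 / 2)))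
    have h2 := gaussianReal_const_add (gaussianReal_const_mul h (σ : ℝ)) a
    have := h2.map_eq
    simp only [id, mul_zero, zero_add] at this
    rw [this]
    congr 1
    ext
    simp [div_eq_mul_inv]
  unfold complexNormal
  rw [key, key, Measure.map_prod_map _ _ (by fun_prop) (by fun_prop),
    Measure.map_map measurable_complex_mk (by fun_prop),
    Measure.map_map (by fun_prop) measurable_complex_mk]
  congr 1
  funext p
  apply Complex.ext <;> simp

lemma integral_complexNormal {E : Type*} [NormedAddCommGroup E] [NormedSpace ℝ E] (m : ℂ) (v : ℝ≥0)
    (f : ℂ → E) :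
    ∫ z, f z ∂(complexNormal m v) = ∫ p : ℝ × ℝ, f ⟨p.1, p.2⟩
      ∂((gaussianReal m.re (v / 2)).prod (gaussianReal m.im (v / 2))) :=
  integral_map_equiv Complex.measurableEquivRealProd.symm f

lemma memLp_id_complexNormal (m : ℂ) (v : ℝ≥0) : MemLp (fun z : ℂ => z) 2 (complexNormal m v) := by
  unfold complexNormal
  rw [memLp_map_measure_iff (by fun_prop) measurable_complex_mk.aemeasurable]
  have h1 : MemLp (fun p : ℝ × ℝ => p.1) 2
      ((gaussianReal m.re (v / 2)).prod (gaussianReal m.im (v / 2))) :=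
    (memLp_id_gaussianReal 2).comp_fst _
  have h2 : MemLp (fun p : ℝ × ℝ => p.2) 2
      ((gaussianReal m.re (v / 2)).prod (gaussianReal m.im (v / 2))) :=
    (memLp_id_gaussianReal 2).comp_snd _
  have := (h1.ofReal (K := ℂ)).add ((h2.ofReal (K := ℂ)).mul_const Complex.I)
  convert this using 1
  funext p
  apply Complex.ext <;> simp

lemma integral_id_complexNormal : ∫ z, z ∂(complexNormal 0 1) = 0 := by
  have h := (memLp_id_complexNormal 0 1).integrable (by norm_num)
  apply Complex.ext
  · have := integral_re h
    simp only [RCLike.re_to_complex] at this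
    rw [← this, integral_complexNormal]
    simpa using integral_prod_mul (μ := gaussianReal 0 (1 / 2)) (ν := gaussianReal 0 (1 / 2))
      (fun x : ℝ => x) (fun _ => (1 : ℝ))
  · have := integral_im h
    simp only [RCLike.im_to_complex] at this
    rw [← this, integral_complexNormal]
    simpa using integral_prod_mul (μ := gaussianReal 0 (1 / 2)) (ν := gaussianReal 0 (1 / 2))
      (fun _ => (1 : ℝ)) (fun x : ℝ => x)

lemma integral_sq_gaussianReal (v : ℝ≥0) : ∫ x, x ^ 2 ∂(gaussianReal 0 v) = v := by
  have := variance_fun_id_gaussianReal (μ := 0) (v := v)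
  rw [variance_of_integral_eq_zero (by fun_prop) (by simp)] at this
  exact this

lemma integral_mul_conj_complexNormal : ∫ z, z * conj z ∂(complexNormal 0 1) = 1 := by
  rw [integral_complexNormal]
  have h : ∀ p : ℝ × ℝ, (⟨p.1, p.2⟩ : ℂ) * conj (⟨p.1, p.2⟩ : ℂ) = ((p.1 ^ 2 + p.2 ^ 2 : ℝ) : ℂ) := by
    intro p
    rw [Complex.mul_conj, Complex.normSq_mk]
    congr 1
    ring
  simp only [h]
  rw [integral_complex_ofReal]
  have i1 : Integrable (fun x : ℝ => x ^ 2) (gaussianReal 0 (1 / 2)) :=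
    (memLp_id_gaussianReal 2).integrable_sq
  simp only [Complex.zero_re, Complex.zero_im]
  have h1 := integral_prod_mul (μ := gaussianReal 0 (1 / 2)) (ν := gaussianReal 0 (1 / 2))
    (fun x : ℝ => x ^ 2) (fun _ => (1 : ℝ))
  have h2 := integral_prod_mul (μ := gaussianReal 0 (1 / 2)) (ν := gaussianReal 0 (1 / 2))
    (fun _ => (1 : ℝ)) (fun x : ℝ => x ^ 2)
  simp only [mul_one, one_mul, integral_sq_gaussianReal, integral_const, probReal_univ,
    smul_eq_mul] at h1 h2
  rw [integral_add (i1.comp_fst _) (i1.comp_snd _), h1, h2]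
  norm_num

/-- Re (d z) is a combination of two independent real normals of variance 1/2, hence centred normal
with variance ‖d‖² / 2. -/
lemma integral_exp_re_mul_complexNormal (d : ℂ) :
    ∫ z, Complex.exp (((d * z).re : ℝ) * Complex.I) ∂(complexNormal 0 1) =
      Complex.exp (-(‖d‖ ^ 2 / 4 : ℝ)) := by
  rw [integral_complexNormal]
  have h : ∀ p : ℝ × ℝ, Complex.exp (((d * (⟨p.1, p.2⟩ : ℂ)).re : ℝ) * Complex.I) =
      Complex.exp (d.re * p.1 * Complex.I) * Complex.exp (((-d.im : ℝ) : ℂ) * p.2 * Complex.I) := by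
    intro p
    rw [← Complex.exp_add]
    congr 1
    simp
    ring
  simp only [h, Complex.zero_re, Complex.zero_im]
  rw [integral_prod_mul (fun x : ℝ => Complex.exp (d.re * x * Complex.I))
    (fun y : ℝ => Complex.exp (((-d.im : ℝ) : ℂ) * y * Complex.I))]
  rw [← charFun_apply_real, ← charFun_apply_real, charFun_gaussianReal, charFun_gaussianReal,
    ← Complex.exp_add]
  congr 1
  have := Complex.sq_norm d
  rw [this, Complex.normSq_apply]
  push_cast
  ring

end ComplexNormal

/-! ### Orthonormality of independent standard complex normals -/

section Orthonormal

variable {ι κ : Type*} [Fintype ι] [Fintype κ]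

/-- The law of a family of independent standard complex normals. -/
noncomputable abbrev stdComplexNormalPi (ι : Type*) [Fintype ι] : Measure (ι → ℂ) :=
  Measure.pi fun _ : ι => complexNormal 0 1

/-- The coordinate functions, together with the constant function `1`. -/
def coordOrOne : Option ι → (ι → ℂ) → ℂ
  | none, _ => 1
  | some i, x => x i

lemma memLp_coordOrOne (p : Option ι) : MemLp (coordOrOne p) 2 (stdComplexNormalPi ι) := by
  cases p with
  | none => exact memLp_const 1
  | some i =>
    exact (memLp_id_complexNormal 0 1).comp_measurePreserving (measurePreserving_eval _ i)

lemma integral_eval_stdComplexNormalPi (i : ι) (f : ℂ → ℂ) (hf : Measurable f) :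
    ∫ x, f (x i) ∂(stdComplexNormalPi ι) = ∫ z, f z ∂(complexNormal 0 1) := by
  have := (measurePreserving_eval (fun _ : ι => complexNormal 0 1) i).map_eq
  conv_rhs => rw [← this]
  rw [integral_map (measurable_pi_apply i).aemeasurable hf.aestronglyMeasurable]

/-- Independence factors the mixed moments and zero means kill them. Including the constant 1 lets
single coordinates and mixed products be treated alike, as one factor from each family. -/
lemma integral_coordOrOne_mul_conj [DecidableEq ι] (p q : Option ι) :
    ∫ x, coordOrOne p x * conj (coordOrOne q x) ∂(stdComplexNormalPi ι) = if p = q then 1 else 0 := by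
  rcases p with _ | i <;> rcases q with _ | j
  · simp [coordOrOne]
  · simp only [coordOrOne, one_mul, integral_conj]
    rw [integral_eval_stdComplexNormalPi j (fun z => z) (by fun_prop), integral_id_complexNormal]
    simp
  · simp only [coordOrOne, map_one, mul_one]
    rw [integral_eval_stdComplexNormalPi i (fun z => z) (by fun_prop), integral_id_complexNormal]
    simp
  · simp only [coordOrOne, Option.some.injEq]
    split_ifs with h
    · subst h
      rw [integral_eval_stdComplexNormalPi i (fun z => z * conj z) (by fun_prop),
        integral_mul_conj_complexNormal]
    · have hi := iIndepFun_pi (μ := fun _ : ι => complexNormal 0 1) (X := fun _ z => z)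
        (fun _ => aemeasurable_id)
      have hij := (hi.indepFun h).comp (φ := fun z : ℂ => z) (ψ := fun z : ℂ => conj z)
        measurable_id Complex.continuous_conj.measurable
      have := hij.integral_fun_mul_eq_mul_integral
        (measurable_pi_apply i).aestronglyMeasurable
        (Complex.continuous_conj.measurable.comp (measurable_pi_apply j)).aestronglyMeasurable
      simp only [Function.comp_apply] at this
      rw [this, integral_eval_stdComplexNormalPi i (fun z => z) (by fun_prop),
        integral_id_complexNormal, zero_mul]

/-- The law of two independent families of independent standard complex normals. -/
noncomputable abbrev stdComplexNormalProd (ι κ : Type*) [Fintype ι] [Fintype κ] :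
    Measure ((ι → ℂ) × (κ → ℂ)) :=
  (stdComplexNormalPi ι).prod (stdComplexNormalPi κ)

end Orthonormal

/-! ### Mixed products of degree at most two -/

section Chaos

variable {ι κ : Type*}

/-- The pair of coordinates (or `1`) that make up a mixed product. -/
def chaosIndex : (ι ⊕ κ) ⊕ (ι × κ) → Option ι × Option κ
  | .inl (.inl i) => (some i, none)
  | .inl (.inr k) => (none, some k)
  | .inr (i, k) => (some i, some k)

/-- The coordinates of two independent families and their mixed products. -/
def chaos (a : (ι ⊕ κ) ⊕ (ι × κ)) (x : (ι → ℂ) × (κ → ℂ)) : ℂ :=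
  coordOrOne (chaosIndex a).1 x.1 * coordOrOne (chaosIndex a).2 x.2

lemma chaosIndex_injective : Function.Injective (chaosIndex : (ι ⊕ κ) ⊕ (ι × κ) → _) := by
  rintro ((i | k) | ⟨i, k⟩) ((i' | k') | ⟨i', k'⟩) h <;> simp_all [chaosIndex]

lemma chaosIndex_ne (a : (ι ⊕ κ) ⊕ (ι × κ)) : chaosIndex a ≠ (none, none) := by
  rcases a with (i | k) | ⟨i, k⟩ <;> simp [chaosIndex]

lemma measurable_chaos (a : (ι ⊕ κ) ⊕ (ι × κ)) : Measurable (chaos a) := by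
  unfold chaos
  rcases a with (i | k) | ⟨i, k⟩ <;> dsimp only [chaosIndex, coordOrOne] <;> fun_prop

variable [Fintype ι] [Fintype κ]

lemma integrable_coordOrOne_mul_conj (p q : Option ι) :
    Integrable (fun x => coordOrOne p x * conj (coordOrOne q x)) (stdComplexNormalPi ι) :=
  (memLp_coordOrOne p).integrable_mul (memLp_coordOrOne q).star

lemma integrable_chaos_mul_conj (a b : (ι ⊕ κ) ⊕ (ι × κ)) :
    Integrable (fun x => chaos a x * conj (chaos b x)) (stdComplexNormalProd ι κ) := by
  have := (integrable_coordOrOne_mul_conj (chaosIndex a).1 (chaosIndex b).1).mul_prod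
    (integrable_coordOrOne_mul_conj (chaosIndex a).2 (chaosIndex b).2)
  refine this.congr (ae_of_all _ fun x => ?_)
  simp only [chaos, map_mul]
  ring

/-- By Fubini, products of two orthonormal systems are orthonormal; injectivity of `chaosIndex`
keeps distinct labels distinct. -/
lemma integral_chaos_mul_conj [DecidableEq ι] [DecidableEq κ] (a b : (ι ⊕ κ) ⊕ (ι × κ)) :
    ∫ x, chaos a x * conj (chaos b x) ∂(stdComplexNormalProd ι κ) = if a = b then 1 else 0 := by
  have := integral_prod_mul (μ := stdComplexNormalPi ι) (ν := stdComplexNormalPi κ)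
    (fun x => coordOrOne (chaosIndex a).1 x * conj (coordOrOne (chaosIndex b).1 x))
    (fun x => coordOrOne (chaosIndex a).2 x * conj (coordOrOne (chaosIndex b).2 x))
  rw [integral_coordOrOne_mul_conj, integral_coordOrOne_mul_conj] at this
  have h2 : (a = b) ↔ (chaosIndex a).1 = (chaosIndex b).1 ∧ (chaosIndex a).2 = (chaosIndex b).2 := by
    rw [← Prod.ext_iff, chaosIndex_injective.eq_iff]
  simp only [h2, ite_and]
  have h3 (p q : Prop) [Decidable p] [Decidable q] : (if p then if q then (1 : ℂ) else 0 else 0) =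
      (if p then 1 else 0) * (if q then 1 else 0) := by split_ifs <;> simp
  rw [h3, ← this]
  refine integral_congr_ae (ae_of_all _ fun x => ?_)
  simp only [chaos, map_mul]
  ring

/-- Orthogonality to the constant function, whose index pair `(none, none)` is not a value of
`chaosIndex`. -/
lemma integral_chaos (a : (ι ⊕ κ) ⊕ (ι × κ)) :
    ∫ x, chaos a x ∂(stdComplexNormalProd ι κ) = 0 := by
  classical
  have := integral_prod_mul (μ := stdComplexNormalPi ι) (ν := stdComplexNormalPi κ)
    (fun x => coordOrOne (chaosIndex a).1 x * conj (coordOrOne none x))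
    (fun x => coordOrOne (chaosIndex a).2 x * conj (coordOrOne none x))
  rw [integral_coordOrOne_mul_conj, integral_coordOrOne_mul_conj] at this
  have h1 (x : ι → ℂ) : coordOrOne none x = 1 := rfl
  have h2 (x : κ → ℂ) : coordOrOne none x = 1 := rfl
  simp only [h1, h2, map_one, mul_one] at this
  unfold chaos
  rw [this]
  have := chaosIndex_ne a
  rw [Ne, Prod.ext_iff, not_and_or] at this
  rcases this with h | h <;> simp [h]

lemma memLp_chaos (a : (ι ⊕ κ) ⊕ (ι × κ)) : MemLp (chaos a) 2 (stdComplexNormalProd ι κ) := by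
  rw [memLp_two_iff_integrable_sq_norm (measurable_chaos a).aestronglyMeasurable]
  refine (integrable_chaos_mul_conj a a).norm.congr (ae_of_all _ fun x => ?_)
  simp [sq]

/-- A linear combination of the mixed products of degree at most two, without constant term. -/
noncomputable def chaosSum (c : (ι ⊕ κ) ⊕ (ι × κ) → ℂ) (x : (ι → ℂ) × (κ → ℂ)) : ℂ :=
  ∑ a, c a * chaos a x

@[fun_prop]
lemma measurable_chaosSum (c : (ι ⊕ κ) ⊕ (ι × κ) → ℂ) : Measurable (chaosSum c) :=
  Finset.measurable_sum _ fun a _ => (measurable_chaos a).const_mul _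

lemma memLp_chaosSum (c : (ι ⊕ κ) ⊕ (ι × κ) → ℂ) :
    MemLp (chaosSum c) 2 (stdComplexNormalProd ι κ) :=
  memLp_finsetSum _ fun a _ => (memLp_chaos a).const_mul _

lemma integral_chaosSum (c : (ι ⊕ κ) ⊕ (ι × κ) → ℂ) :
    ∫ x, chaosSum c x ∂(stdComplexNormalProd ι κ) = 0 := by
  unfold chaosSum
  rw [integral_finsetSum _ fun a _ => ((memLp_chaos a).integrable (by norm_num)).const_mul _]
  simp [integral_const_mul, integral_chaos]

lemma integral_chaosSum_mul_conj (c d : (ι ⊕ κ) ⊕ (ι × κ) → ℂ) :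
    ∫ x, chaosSum c x * conj (chaosSum d x) ∂(stdComplexNormalProd ι κ) = ∑ a, c a * conj (d a) := by
  classical
  have h (x : (ι → ℂ) × (κ → ℂ)) : chaosSum c x * conj (chaosSum d x) =
      ∑ a, ∑ b, c a * conj (d b) * (chaos a x * conj (chaos b x)) := by
    simp only [chaosSum, map_sum, Finset.sum_mul_sum, map_mul]
    exact Finset.sum_congr rfl fun a _ => Finset.sum_congr rfl fun b _ => by ring
  simp only [h]
  rw [integral_finsetSum _ fun a _ => integrable_finsetSum _ fun b _ =>
    (integrable_chaos_mul_conj a b).const_mul _]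
  refine Finset.sum_congr rfl fun a _ => ?_
  rw [integral_finsetSum _ fun b _ => (integrable_chaos_mul_conj a b).const_mul _]
  simp [integral_const_mul, integral_chaos_mul_conj]

end Chaos

/-! ### Linear images of standard complex normal vectors -/

section GaussianVector

variable {ι κ : Type*} [Fintype ι] [Fintype κ] {N : ℕ}

/-- The complex coefficient vector of a real functional on `ℂᴺ`. -/
noncomputable def dualCoeff (L : StrongDual ℝ (Fin N → ℂ)) (n : Fin N) : ℂ :=
  ⟨L (Pi.single n 1), -L (Pi.single n Complex.I)⟩

lemma dual_apply_eq_re_dotProduct (L : StrongDual ℝ (Fin N → ℂ)) (z : Fin N → ℂ) :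
    L z = (dualCoeff L ⬝ᵥ z).re := by
  have hz : z = ∑ n, ((z n).re • (Pi.single n 1 : Fin N → ℂ) +
      (z n).im • (Pi.single n Complex.I : Fin N → ℂ)) := by
    funext j
    simp [Finset.sum_apply, Pi.single_apply, Finset.sum_add_distrib]
  conv_lhs => rw [hz]
  simp only [map_sum, map_add, map_smul, dotProduct, Complex.re_sum]
  refine Finset.sum_congr rfl fun n _ => ?_
  simp [dualCoeff]
  ring

lemma integral_exp_re_dotProduct (d : ι → ℂ) :
    ∫ x, Complex.exp (((d ⬝ᵥ x).re : ℝ) * Complex.I) ∂(stdComplexNormalPi ι) =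
      Complex.exp (-((d ⬝ᵥ star d).re / 4 : ℝ)) := by
  have h (x : ι → ℂ) : Complex.exp (((d ⬝ᵥ x).re : ℝ) * Complex.I) =
      ∏ i, Complex.exp (((d i * x i).re : ℝ) * Complex.I) := by
    rw [← Complex.exp_sum, dotProduct, Complex.re_sum, Complex.ofReal_sum, Finset.sum_mul]
  simp only [h]
  rw [integral_fintype_prod_eq_prod (fun i (z : ℂ) => Complex.exp (((d i * z).re : ℝ) * Complex.I))]
  simp only [integral_exp_re_mul_complexNormal]
  rw [← Complex.exp_sum, dotProduct, Complex.re_sum]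
  congr 1
  rw [Finset.sum_neg_distrib, ← Complex.ofReal_sum, ← Finset.sum_div]
  congr 4
  funext i
  rw [Complex.sq_norm, Pi.star_apply, RCLike.star_def, Complex.mul_conj, Complex.ofReal_re]

@[fun_prop]
lemma measurable_matrix_mulVec (A : Matrix (Fin N) ι ℂ) : Measurable A.mulVec :=
  (Continuous.matrix_mulVec continuous_const continuous_id).measurable

/-- The point is that A enters only through A Aᴴ, so this matrix determines the law. -/
lemma charFunDual_map_mulVec (A : Matrix (Fin N) ι ℂ) (L : StrongDual ℝ (Fin N → ℂ)) :
    charFunDual ((stdComplexNormalPi ι).map A.mulVec) L =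
      Complex.exp (-(((Matrix.vecMul (dualCoeff L) (A * A.conjTranspose)) ⬝ᵥ
        star (dualCoeff L)).re / 4 : ℝ)) := by
  rw [charFunDual_apply, integral_map (by fun_prop) (by fun_prop)]
  simp only [dual_apply_eq_re_dotProduct, Matrix.dotProduct_mulVec]
  rw [integral_exp_re_dotProduct, Matrix.star_vecMul, Matrix.dotProduct_mulVec,
    Matrix.vecMul_vecMul]

lemma map_mulVec_eq_of_mul_conjTranspose_eq (A : Matrix (Fin N) ι ℂ) (B : Matrix (Fin N) κ ℂ)
    (h : A * A.conjTranspose = B * B.conjTranspose) :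
    (stdComplexNormalPi ι).map A.mulVec = (stdComplexNormalPi κ).map B.mulVec := by
  have := Measure.isProbabilityMeasure_map (μ := stdComplexNormalPi ι)
    (measurable_matrix_mulVec A).aemeasurable
  have := Measure.isProbabilityMeasure_map (μ := stdComplexNormalPi κ)
    (measurable_matrix_mulVec B).aemeasurable
  refine Measure.ext_of_charFunDual (funext fun L => ?_)
  rw [charFunDual_map_mulVec, charFunDual_map_mulVec, h]

-- `IsComplexNormalVector` asks for a square factor, whereas the coefficient matrices are
-- rectangular; positive semidefiniteness of A Aᴴ supplies one.
open scoped ComplexOrder MatrixOrder in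
lemma exists_square_mul_conjTranspose_eq (A : Matrix (Fin N) ι ℂ) :
    ∃ B : Matrix (Fin N) (Fin N) ℂ, B * B.conjTranspose = A * A.conjTranspose := by
  obtain ⟨B, hB⟩ := CStarAlgebra.nonneg_iff_eq_star_mul_self.mp
    (Matrix.posSemidef_self_mul_conjTranspose A).nonneg
  exact ⟨B.conjTranspose, by rw [hB, Matrix.conjTranspose_conjTranspose]; rfl⟩

lemma isComplexNormalVector_map_mulVec (A : Matrix (Fin N) ι ℂ) :
    IsComplexNormalVector ((stdComplexNormalPi ι).map A.mulVec) 0 (A * A.conjTranspose) := by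
  obtain ⟨B, hB⟩ := exists_square_mul_conjTranspose_eq A
  refine ⟨B, hB, ?_⟩
  simp only [zero_add]
  exact map_mulVec_eq_of_mul_conjTranspose_eq A B hB.symm

lemma IsComplexNormalVector.eq_of_one {ν : Measure (Fin N → ℂ)}
    (h : IsComplexNormalVector ν 0 1) : ν = stdComplexNormalPi (Fin N) := by
  obtain ⟨A, hA, rfl⟩ := h
  simp only [zero_add]
  have := map_mulVec_eq_of_mul_conjTranspose_eq A (1 : Matrix (Fin N) (Fin N) ℂ) (by simp [hA])
  rw [show (fun ζ => A.mulVec ζ) = A.mulVec from rfl, this]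
  have h1 : (1 : Matrix (Fin N) (Fin N) ℂ).mulVec = id := by
    funext x
    simp
  rw [h1, Measure.map_id]

end GaussianVector

/-! ### Replacing mixed products by independent normals -/

section Limit

/-- Neither sequence need converge: both stay in a compact ball, on which f is uniformly continuous.
-/
lemma tendsto_sub_of_bounded_of_tendsto_sub {E : Type*} [NormedAddCommGroup E] [ProperSpace E]
    {f : E → ℝ} (hf : Continuous f) {u v : ℕ → E} {C : ℝ} (hu : ∀ k, ‖u k‖ ≤ C)
    (hv : ∀ k, ‖v k‖ ≤ C) (h : Tendsto (fun k => u k - v k) atTop (𝓝 0)) :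
    Tendsto (fun k => f (u k) - f (v k)) atTop (𝓝 0) := by
  have hc := (isCompact_closedBall (0 : E) C).uniformContinuousOn_of_continuous hf.continuousOn
  rw [Metric.uniformContinuousOn_iff] at hc
  rw [Metric.tendsto_atTop] at h ⊢
  intro ε hε
  obtain ⟨δ, hδ, H⟩ := hc ε hε
  obtain ⟨K, hK⟩ := h δ hδ
  refine ⟨K, fun k hk => ?_⟩
  have := H (u k) (by simpa using hu k) (v k) (by simpa using hv k)
    (by simpa [dist_eq_norm] using hK k hk)
  simpa [dist_eq_norm] using this

variable {ι κ : Type*} [Fintype ι] [Fintype κ] {N : ℕ}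

/-- Concatenation of two families of variables and a family standing for their mixed products. -/
def chaosConcat (p : ((ι → ℂ) × (κ → ℂ)) × (ι × κ → ℂ)) : (ι ⊕ κ) ⊕ (ι × κ) → ℂ :=
  Sum.elim (Sum.elim p.1.1 p.1.2) p.2

lemma measurePreserving_chaosConcat :
    MeasurePreserving (chaosConcat (ι := ι) (κ := κ))
      ((stdComplexNormalProd ι κ).prod (stdComplexNormalPi (ι × κ)))
      (stdComplexNormalPi ((ι ⊕ κ) ⊕ (ι × κ))) := by
  have h1 := measurePreserving_sumPiEquivProdPi_symm
    (fun _ : ι ⊕ κ => complexNormal 0 1)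
  have h2 := measurePreserving_sumPiEquivProdPi_symm
    (fun _ : (ι ⊕ κ) ⊕ (ι × κ) => complexNormal 0 1)
  have h3 := h2.comp (h1.prod (MeasurePreserving.id (stdComplexNormalPi (ι × κ))))
  convert h3 using 1
  funext p a
  rcases a with (i | k) | b <;> rfl

lemma norm_sum_mul_le {α : Type*} [Fintype α] (c w : α → ℂ) (hc : ∀ a, ‖c a‖ ≤ 1) :
    ‖∑ a, c a * w a‖ ≤ ∑ a, ‖w a‖ := by
  refine norm_sum_le_of_le _ fun a _ => ?_
  rw [norm_mul]
  exact mul_le_of_le_one_left (norm_nonneg _) (hc a)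

/-- If the coefficients of the mixed products vanish in the limit, then chaos sums are
asymptotically Gaussian. -/
lemma tendsto_integral_chaosSum_sub (T : ℕ → Matrix (Fin N) ((ι ⊕ κ) ⊕ (ι × κ)) ℂ)
    (hT : ∀ k n a, ‖T k n a‖ ≤ 1)
    (h0 : ∀ n b, Tendsto (fun k => T k n (.inr b)) atTop (𝓝 0)) (f : (Fin N → ℂ) →ᵇ ℝ) :
    Tendsto (fun k => ∫ x, f (fun n => chaosSum (T k n) x) ∂(stdComplexNormalProd ι κ) -
      ∫ y, f y ∂((stdComplexNormalPi _).map (T k).mulVec)) atTop (𝓝 0) := by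
  -- Coupling: both vectors live on one space and share the degree-one variables; the last factor
  -- carries the substitutes for the products.
  let τ := (stdComplexNormalProd ι κ).prod (stdComplexNormalPi (ι × κ))
  have hm1 (k : ℕ) : Measurable
      (fun p : ((ι → ℂ) × (κ → ℂ)) × (ι × κ → ℂ) => fun n => chaosSum (T k n) p.1) :=
    measurable_pi_lambda _ fun n => (measurable_chaosSum _).comp measurable_fst
  have hm2 (k : ℕ) : Measurable (fun p : ((ι → ℂ) × (κ → ℂ)) × (ι × κ → ℂ) =>
      (T k).mulVec (chaosConcat p)) :=
    (measurable_matrix_mulVec _).comp measurePreserving_chaosConcat.measurable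
  have i1 (k : ℕ) : Integrable (fun p => f (fun n => chaosSum (T k n) p.1)) τ :=
    Integrable.of_bound (f.continuous.measurable.comp (hm1 k)).aestronglyMeasurable ‖f‖
      (ae_of_all _ fun p => f.norm_coe_le_norm _)
  have i2 (k : ℕ) : Integrable (fun p => f ((T k).mulVec (chaosConcat p))) τ :=
    Integrable.of_bound (f.continuous.measurable.comp (hm2 k)).aestronglyMeasurable ‖f‖
      (ae_of_all _ fun p => f.norm_coe_le_norm _)
  have e (k : ℕ) : ∫ x, f (fun n => chaosSum (T k n) x) ∂(stdComplexNormalProd ι κ) -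
      ∫ y, f y ∂((stdComplexNormalPi _).map (T k).mulVec) =
      ∫ p, (f (fun n => chaosSum (T k n) p.1) - f ((T k).mulVec (chaosConcat p))) ∂τ := by
    rw [integral_sub (i1 k) (i2 k), integral_fun_fst (fun x => f (fun n => chaosSum (T k n) x)),
      ← measurePreserving_chaosConcat.map_eq,
      Measure.map_map (by fun_prop) measurePreserving_chaosConcat.measurable,
      integral_map (φ := (T k).mulVec ∘ chaosConcat) (hm2 k).aemeasurable
        f.continuous.measurable.aestronglyMeasurable]
    simp [τ]
  simp only [e]
  rw [← integral_zero _ ℝ (μ := τ)]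
  refine tendsto_integral_of_dominated_convergence (fun _ => ‖f‖ + ‖f‖)
    (fun k => ((i1 k).sub (i2 k)).aestronglyMeasurable) (integrable_const _)
    (fun k => ae_of_all _ fun p => (norm_sub_le _ _).trans
      (add_le_add (f.norm_coe_le_norm _) (f.norm_coe_le_norm _))) (ae_of_all _ fun p => ?_)
  -- At a fixed sample point, coefficients of modulus at most 1 bound both vectors uniformly in `k`.
  refine tendsto_sub_of_bounded_of_tendsto_sub f.continuous
    (C := max (∑ a, ‖chaos a p.1‖) (∑ a, ‖chaosConcat p a‖)) (fun k => ?_) (fun k => ?_) ?_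
  · refine (pi_norm_le_iff_of_nonneg (le_max_of_le_left (by positivity))).2 fun n => ?_
    exact (norm_sum_mul_le _ _ (hT k n)).trans (le_max_left _ _)
  · refine (pi_norm_le_iff_of_nonneg (le_max_of_le_left (by positivity))).2 fun n => ?_
    exact (norm_sum_mul_le _ _ (hT k n)).trans (le_max_right _ _)
  · rw [tendsto_pi_nhds]
    intro n
    -- The degree-one terms cancel; only terms with vanishing coefficients survive.
    have h1 (k : ℕ) : ((fun n => chaosSum (T k n) p.1) - (T k).mulVec (chaosConcat p)) n =
        ∑ b, T k n (.inr b) * (chaos (.inr b) p.1 - p.2 b) := by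
      simp [chaosSum, Matrix.mulVec, dotProduct, Fintype.sum_sum_type, chaos, chaosIndex,
        coordOrOne, chaosConcat, mul_sub]
    simp only [h1]
    rw [show (0 : Fin N → ℂ) n = ∑ b : ι × κ, 0 * (chaos (.inr b) p.1 - p.2 b) by simp]
    exact tendsto_finsetSum _ fun b _ => (h0 n b).mul_const _

end Limit

/-! ### Expansion and second moments of the received signal -/

namespace RelayNetwork

variable {N M : ℕ} {Ω : Type*} [MeasurableSpace Ω] {P : Measure Ω}

/-- The standard deviation of the base-station part of the relay signals. -/
def σB (S : RelayNetwork N M P) : Hypothesis → ℝ≥0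
  | .H0 => 0
  | .H1 => S.σF

/-- The coefficients of `Y` in the standardized channels and noises and their products. -/
noncomputable def coef (S : RelayNetwork N M P) (h : Hypothesis) (n : Fin N) :
    ((Fin N × Fin M) ⊕ (Fin M ⊕ Fin M ⊕ Fin N)) ⊕
      ((Fin N × Fin M) × (Fin M ⊕ Fin M ⊕ Fin N)) → ℂ
  | .inl (.inl (n', m)) => if n' = n then S.σG * S.Rbar h m else 0
  | .inl (.inr (.inl m)) => S.Gbar n m * S.σB h
  | .inl (.inr (.inr (.inl m))) => S.Gbar n m * S.σV
  | .inl (.inr (.inr (.inr n'))) => if n' = n then S.σW else 0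
  | .inr ((n', m), .inl m') => if n' = n ∧ m' = m then S.σG * S.σB h else 0
  | .inr ((n', m), .inr (.inl m')) => if n' = n ∧ m' = m then S.σG * S.σV else 0
  | .inr (_, .inr (.inr _)) => 0

/-- The sources of randomness as affine functions of standard complex normals. -/
noncomputable def affineSource (S : RelayNetwork N M P)
    (z : (Fin N × Fin M) ⊕ Fin M ⊕ Fin M ⊕ Fin N → ℂ) :
    (Fin N × Fin M) ⊕ Fin M ⊕ Fin M ⊕ Fin N → ℂ
  | .inl (n, m) => S.Gbar n m + S.σG * z (.inl (n, m))
  | .inr (.inl m) => S.Fbar m + S.σF * z (.inr (.inl m))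
  | .inr (.inr (.inl m)) => 0 + S.σV * z (.inr (.inr (.inl m)))
  | .inr (.inr (.inr n)) => 0 + S.σW * z (.inr (.inr (.inr n)))

/-- The received components as a function of the sources of randomness. -/
noncomputable def receive (h : Hypothesis) (z : (Fin N × Fin M) ⊕ Fin M ⊕ Fin M ⊕ Fin N → ℂ)
    (n : Fin N) : ℂ :=
  match h with
  | .H0 => ∑ m, z (.inl (n, m)) * z (.inr (.inr (.inl m))) + z (.inr (.inr (.inr n)))
  | .H1 => ∑ m, z (.inl (n, m)) * (z (.inr (.inl m)) + z (.inr (.inr (.inl m)))) +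
      z (.inr (.inr (.inr n)))

lemma measurable_receive (h : Hypothesis) :
    Measurable (receive (N := N) (M := M) h) := by
  refine measurable_pi_lambda _ fun n => ?_
  cases h <;> simp only [receive] <;> fun_prop

lemma Y_eq_receive (S : RelayNetwork N M P) (h : Hypothesis) (n : Fin N) (ω : Ω) :
    S.Y h n ω = receive h (fun i => Sum.elim (fun j : Fin N × Fin M => S.G j.1 j.2)
      (Sum.elim S.F (Sum.elim S.V S.W)) i ω) n := by
  cases h <;> rfl

lemma hasLaw_sources [IsProbabilityMeasure P] (S : RelayNetwork N M P) :
    HasLaw (fun ω i => Sum.elim (fun j : Fin N × Fin M => S.G j.1 j.2)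
      (Sum.elim S.F (Sum.elim S.V S.W)) i ω)
      ((stdComplexNormalPi ((Fin N × Fin M) ⊕ Fin M ⊕ Fin M ⊕ Fin N)).map S.affineSource) P := by
  have hm (i : (Fin N × Fin M) ⊕ Fin M ⊕ Fin M ⊕ Fin N) :
      AEMeasurable (Sum.elim (fun j : Fin N × Fin M => S.G j.1 j.2)
        (Sum.elim S.F (Sum.elim S.V S.W)) i) P := by
    rcases i with ⟨n, m⟩ | m | m | n
    exacts [(S.law_G n m).aemeasurable, (S.law_F m).aemeasurable, (S.law_V m).aemeasurable,
      (S.law_W n).aemeasurable]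
  refine ⟨aemeasurable_pi_lambda _ hm, ?_⟩
  rw [(iIndepFun_iff_map_fun_eq_pi_map hm).1 S.indep]
  let m : (Fin N × Fin M) ⊕ Fin M ⊕ Fin M ⊕ Fin N → ℂ :=
    Sum.elim (fun j => S.Gbar j.1 j.2) (Sum.elim S.Fbar (Sum.elim 0 0))
  let s : (Fin N × Fin M) ⊕ Fin M ⊕ Fin M ⊕ Fin N → ℝ≥0 :=
    Sum.elim (fun _ => S.σG) (Sum.elim (fun _ => S.σF) (Sum.elim (fun _ => S.σV) fun _ => S.σW))
  have hs : S.affineSource = fun z i => m i + (s i : ℂ) * z i := by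
    funext z i
    rcases i with ⟨n, m⟩ | m | m | n <;> rfl
  rw [hs, Measure.pi_map_pi (f := fun i z => m i + (s i : ℂ) * z) (fun i => by fun_prop)]
  congr 1
  funext i
  rw [← complexNormal_eq_map]
  rcases i with ⟨n, m⟩ | m | m | n
  exacts [(S.law_G n m).map_eq, (S.law_F m).map_eq, (S.law_V m).map_eq, (S.law_W n).map_eq]

/-- Expand (Ḡ + σG ζ)(R̄ + σB ξ + σV η) for each relay. Since σB = 0 under `H0`, one formula serves
both hypotheses. -/
lemma receive_affineSource (S : RelayNetwork N M P) (h : Hypothesis) (n : Fin N)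
    (x : (Fin N × Fin M → ℂ) × (Fin M ⊕ Fin M ⊕ Fin N → ℂ)) :
    receive h (S.affineSource (Sum.elim x.1 x.2)) n =
      ∑ m, S.Gbar n m * S.Rbar h m + chaosSum (S.coef h n) x := by
  have key : chaosSum (S.coef h n) x =
      ∑ m, (S.σG * S.Rbar h m * x.1 (n, m) + S.Gbar n m * S.σB h * x.2 (.inl m) +
        S.Gbar n m * S.σV * x.2 (.inr (.inl m)) +
        S.σG * S.σB h * (x.1 (n, m) * x.2 (.inl m)) +
        S.σG * S.σV * (x.1 (n, m) * x.2 (.inr (.inl m)))) + S.σW * x.2 (.inr (.inr n)) := by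
    simp only [chaosSum, Fintype.sum_sum_type, Fintype.sum_prod_type, coef, chaos, chaosIndex,
      coordOrOne, ite_mul, zero_mul, Finset.sum_ite_irrel, ite_and, Finset.sum_ite_eq',
      Finset.sum_const_zero, Finset.mem_univ, if_true, Finset.sum_add_distrib, mul_one, one_mul,
      add_zero]
    ring
  rw [key, ← add_assoc, ← Finset.sum_add_distrib]
  cases h
  all_goals
    simp only [receive, affineSource, Sum.elim_inl, Sum.elim_inr, zero_add, Rbar, σB]
    congr 1
    refine Finset.sum_congr rfl fun m _ => ?_
    push_cast
    ring

/-- Transfers every expectation to a probability space that is the same for all networks of the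
sequence, so that pointwise limits make sense. -/
lemma hasLaw_Y [IsProbabilityMeasure P] (S : RelayNetwork N M P) (h : Hypothesis) :
    HasLaw (fun ω n => S.Y h n ω) ((stdComplexNormalProd (Fin N × Fin M)
      (Fin M ⊕ Fin M ⊕ Fin N)).map
        (fun x n => ∑ m, S.Gbar n m * S.Rbar h m + chaosSum (S.coef h n) x)) P := by
  have h1 := (HasLaw.mk (μ := (((stdComplexNormalPi _).map S.affineSource).map
    (receive (N := N) (M := M) h))) (measurable_receive h).aemeasurable rfl).comp S.hasLaw_sources
  have hm : Measurable S.affineSource := by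
    refine measurable_pi_lambda _ fun i => ?_
    rcases i with ⟨n, m⟩ | m | m | n <;> simp only [affineSource] <;> fun_prop
  have h2 : MeasurePreserving (MeasurableEquiv.sumPiEquivProdPi fun _ => ℂ).symm
      (stdComplexNormalProd (Fin N × Fin M) (Fin M ⊕ Fin M ⊕ Fin N)) (stdComplexNormalPi _) :=
    measurePreserving_sumPiEquivProdPi_symm (fun _ => complexNormal 0 1)
  have e : (fun ω n => S.Y h n ω) = (receive h ∘ fun ω i =>
      Sum.elim (fun j : Fin N × Fin M => S.G j.1 j.2) (Sum.elim S.F (Sum.elim S.V S.W)) i ω) := by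
    funext ω n
    rw [Y_eq_receive]
    rfl
  rw [e]
  convert h1 using 1
  rw [← h2.map_eq, Measure.map_map hm h2.measurable,
    Measure.map_map (measurable_receive h) (hm.comp h2.measurable)]
  congr 1
  funext x n
  exact (S.receive_affineSource h n x).symm

/-- The variance of a received component. -/
noncomputable def rowSq (S : RelayNetwork N M P) (h : Hypothesis) (n : Fin N) : ℝ :=
  ∑ a, ‖S.coef h n a‖ ^ 2

variable (S : RelayNetwork N M P) (h : Hypothesis) (n : Fin N)

lemma norm_coef_sq_le_rowSq (a) : ‖S.coef h n a‖ ^ 2 ≤ S.rowSq h n :=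
  Finset.single_le_sum (f := fun a => ‖S.coef h n a‖ ^ 2) (fun _ _ => by positivity)
    (Finset.mem_univ a)

lemma rowSq_pos : 0 < S.rowSq h n := by
  -- The coefficient of the receiver noise is σW > 0.
  refine lt_of_lt_of_le ?_ (S.norm_coef_sq_le_rowSq h n (.inl (.inr (.inr (.inr n)))))
  have : 0 < (S.σW : ℝ) := S.σW_pos
  simp only [coef, if_true, Complex.norm_real, Real.norm_eq_abs]
  positivity

lemma σR_sq : (S.σR h : ℝ) ^ 2 = S.σB h ^ 2 + S.σV ^ 2 := by
  cases h
  · simp [σR, σB]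
  · have hs : S.σR .H1 ^ 2 = S.σF ^ 2 + S.σV ^ 2 := NNReal.sq_sqrt _
    have := congrArg NNReal.toReal hs
    rwa [NNReal.coe_add, NNReal.coe_pow, NNReal.coe_pow, NNReal.coe_pow] at this

lemma norm_coef_inr_sq_le (b) : ‖S.coef h n (.inr b)‖ ^ 2 ≤ (S.σG : ℝ) ^ 2 * S.σR h ^ 2 := by
  rw [σR_sq]
  have hB : 0 ≤ (S.σG : ℝ) ^ 2 * (S.σB h : ℝ) ^ 2 := by positivity
  have hV : 0 ≤ (S.σG : ℝ) ^ 2 * (S.σV : ℝ) ^ 2 := by positivity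
  rcases b with ⟨⟨n', m⟩, m' | m' | n''⟩ <;> simp only [coef]
  · split_ifs
    · simp [mul_pow]
      linarith
    · simp
      linarith
  · split_ifs
    · simp [mul_pow]
      linarith
    · simp
      linarith
  · simp
    linarith

/-- The coefficients Ḡ σB and Ḡ σV are taken together, as σR² = σB² + σV². -/
lemma norm_Gbar_sq_le_rowSq (m : Fin M) : ‖S.Gbar n m‖ ^ 2 * S.σR h ^ 2 ≤ S.rowSq h n := by
  have := Finset.sum_le_univ_sum_of_nonneg (f := fun a => ‖S.coef h n a‖ ^ 2)
    (fun _ => by positivity) (s := {.inl (.inr (.inl m)), .inl (.inr (.inr (.inl m)))})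
  rw [Finset.sum_pair (by simp)] at this
  refine le_trans (le_of_eq ?_) this
  simp [coef, σR_sq, mul_pow]
  ring

lemma norm_Rbar_sq_le_rowSq (m : Fin M) : (S.σG : ℝ) ^ 2 * ‖S.Rbar h m‖ ^ 2 ≤ S.rowSq h n := by
  refine le_trans (le_of_eq ?_) (S.norm_coef_sq_le_rowSq h n (.inl (.inl (n, m))))
  simp [coef, mul_pow]

lemma ρG_sq_mul_le_rowSq (m : Fin M) :
    S.ρG n m ^ 2 * ((S.σG : ℝ) ^ 2 * S.σR h ^ 2) ≤ S.rowSq h n := by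
  refine le_trans (le_of_eq ?_) (S.norm_Gbar_sq_le_rowSq h n m)
  have : (S.σG : ℝ) ≠ 0 := by exact_mod_cast S.σG_pos.ne'
  rw [ρG]
  field_simp

lemma ρR_sq_mul_le_rowSq (m : Fin M) :
    S.ρR h m ^ 2 * ((S.σG : ℝ) ^ 2 * S.σR h ^ 2) ≤ S.rowSq h n := by
  refine le_trans ?_ (S.norm_Rbar_sq_le_rowSq h n m)
  rw [ρR]
  -- σR = 0 occurs under `H0` without relay noise; the ratio is then 0 by the convention for
  -- division.
  rcases eq_or_ne (S.σR h : ℝ) 0 with h0 | h0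
  · rw [h0, div_zero, zero_pow two_ne_zero, zero_mul]
    positivity
  · field_simp
    exact le_rfl

/-- The constant comes from σR² = σF² + σV² ≤ (1 + c²) σF². -/
lemma ρF_le_mul_ρR {c : ℝ≥0} (hc : S.σV ≤ c * S.σF) (m : Fin M) :
    S.ρF m ≤ Real.sqrt (1 + c ^ 2) * S.ρR .H1 m := by
  have hF : 0 < (S.σF : ℝ) := S.σF_pos
  have hc' : (S.σV : ℝ) ≤ c * S.σF := by exact_mod_cast hc
  have h1 : (S.σR .H1 : ℝ) ≤ Real.sqrt (1 + c ^ 2) * S.σF := by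
    refine le_of_sq_le_sq ?_ (by positivity)
    rw [σR_sq, mul_pow, Real.sq_sqrt (by positivity)]
    have : (S.σV : ℝ) ^ 2 ≤ (c * S.σF) ^ 2 := by gcongr
    simp only [σB]
    linarith [mul_pow (c : ℝ) S.σF 2]
  have h2 : 0 < (S.σR .H1 : ℝ) := by
    have := S.σR_sq .H1
    simp only [σB] at this
    exact lt_of_le_of_ne (NNReal.coe_nonneg _) fun h0 => by
      rw [← h0] at this
      nlinarith [sq_nonneg (S.σV : ℝ), pow_pos hF 2]
  rw [ρF, ρR, Rbar, div_le_iff₀ hF, mul_comm (Real.sqrt _), mul_assoc, div_mul_eq_mul_div,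
    le_div_iff₀ h2]
  gcongr

/-- The coefficients of the standardized components. -/
noncomputable def stdCoef : Matrix (Fin N) (((Fin N × Fin M) ⊕ (Fin M ⊕ Fin M ⊕ Fin N)) ⊕
    ((Fin N × Fin M) × (Fin M ⊕ Fin M ⊕ Fin N))) ℂ :=
  Matrix.of fun n a => S.coef h n a / (Real.sqrt (S.rowSq h n) : ℂ)

lemma norm_stdCoef (a) : ‖S.stdCoef h n a‖ = ‖S.coef h n a‖ / Real.sqrt (S.rowSq h n) := by
  rw [stdCoef, Matrix.of_apply, norm_div, Complex.norm_real, Real.norm_eq_abs,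
    abs_of_nonneg (Real.sqrt_nonneg _)]

lemma norm_stdCoef_le_one (a) : ‖S.stdCoef h n a‖ ≤ 1 := by
  rw [norm_stdCoef]
  exact div_le_one_of_le₀ (Real.le_sqrt_of_sq_le (S.norm_coef_sq_le_rowSq h n a))
    (Real.sqrt_nonneg _)

lemma norm_stdCoef_inr_le {r : ℝ} (hr : 0 < r)
    (hle : r ^ 2 * ((S.σG : ℝ) ^ 2 * S.σR h ^ 2) ≤ S.rowSq h n) (b) :
    ‖S.stdCoef h n (.inr b)‖ ≤ r⁻¹ := by
  rw [norm_stdCoef, div_le_iff₀ (Real.sqrt_pos.2 (S.rowSq_pos h n)), ← div_eq_inv_mul,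
    le_div_iff₀ hr]
  refine Real.le_sqrt_of_sq_le (le_trans ?_ hle)
  rw [mul_pow, mul_comm]
  gcongr
  exact S.norm_coef_inr_sq_le h n b

variable [IsProbabilityMeasure P]

lemma integral_comp_Y {E : Type*} [NormedAddCommGroup E] [NormedSpace ℝ E]
    (φ : (Fin N → ℂ) → E) (hφ : StronglyMeasurable φ) :
    ∫ ω, φ (fun n => S.Y h n ω) ∂P = ∫ x, φ (fun n => ∑ m, S.Gbar n m * S.Rbar h m +
      chaosSum (S.coef h n) x) ∂(stdComplexNormalProd (Fin N × Fin M) (Fin M ⊕ Fin M ⊕ Fin N)) := by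
  rw [← integral_map (φ := fun x n => ∑ m, S.Gbar n m * S.Rbar h m + chaosSum (S.coef h n) x)
    (by fun_prop) hφ.aestronglyMeasurable]
  exact (S.hasLaw_Y h).integral_comp hφ.aestronglyMeasurable

lemma meanY_eq : S.meanY h n = ∑ m, S.Gbar n m * S.Rbar h m := by
  rw [meanY, S.integral_comp_Y h (fun y => y n)
    (Continuous.stronglyMeasurable (by fun_prop)), integral_add (integrable_const _)
    ((memLp_chaosSum _).integrable (by norm_num)), integral_chaosSum]
  simp

lemma integral_Y_mul_conj (n n' : Fin N) :
    ∫ ω, (S.Y h n ω - S.meanY h n) * conj (S.Y h n' ω - S.meanY h n') ∂P =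
      ∑ a, S.coef h n a * conj (S.coef h n' a) := by
  rw [S.integral_comp_Y h (fun y => (y n - S.meanY h n) * conj (y n' - S.meanY h n'))
    (Continuous.stronglyMeasurable (by fun_prop))]
  simp only [meanY_eq, add_sub_cancel_left]
  exact integral_chaosSum_mul_conj _ _

lemma varY_eq : S.varY h n = S.rowSq h n := by
  have h1 := S.integral_Y_mul_conj h n n
  simp only [Complex.mul_conj, Complex.normSq_eq_norm_sq] at h1
  rw [integral_complex_ofReal, ← Complex.ofReal_sum] at h1
  exact Complex.ofReal_injective h1

lemma memLp_Y : MemLp (S.Y h n) 2 P := by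
  have h1 : MemLp (fun x => ∑ m, S.Gbar n m * S.Rbar h m + chaosSum (S.coef h n) x) 2
      (stdComplexNormalProd (Fin N × Fin M) (Fin M ⊕ Fin M ⊕ Fin N)) :=
    (memLp_const (∑ m, S.Gbar n m * S.Rbar h m)).add (memLp_chaosSum (S.coef h n))
  have hm : AEStronglyMeasurable (fun y : Fin N → ℂ => y n) (P.map fun ω n => S.Y h n ω) :=
    (measurable_pi_apply n).aestronglyMeasurable
  refine (memLp_map_measure_iff hm (S.hasLaw_Y h).aemeasurable).1 ?_
  rw [(S.hasLaw_Y h).map_eq] at hm ⊢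
  exact (memLp_map_measure_iff hm (Measurable.aemeasurable (by fun_prop))).2 h1

/-- Parseval's identity for the orthonormal system, divided by the standard deviations. -/
lemma corrY_eq : S.corrY h = S.stdCoef h * (S.stdCoef h).conjTranspose := by
  ext n n'
  have e (ω : Ω) : S.stdY h n ω * conj (S.stdY h n' ω) =
      (S.Y h n ω - S.meanY h n) * conj (S.Y h n' ω - S.meanY h n') /
        ((Real.sqrt (S.varY h n) : ℂ) * (Real.sqrt (S.varY h n') : ℂ)) := by
    simp only [stdY, map_div₀, Complex.conj_ofReal]
    ring
  simp only [corrY, Matrix.of_apply, e]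
  rw [integral_div, integral_Y_mul_conj, Finset.sum_div, Matrix.mul_apply]
  refine Finset.sum_congr rfl fun a _ => ?_
  simp only [stdCoef, Matrix.conjTranspose_apply, Matrix.of_apply, varY_eq, RCLike.star_def,
    map_div₀, Complex.conj_ofReal]
  ring

lemma integral_stdY (f : (Fin N → ℂ) →ᵇ ℝ) :
    ∫ ω, f (fun n => S.stdY h n ω) ∂P = ∫ x, f (fun n => chaosSum (S.stdCoef h n) x)
      ∂(stdComplexNormalProd (Fin N × Fin M) (Fin M ⊕ Fin M ⊕ Fin N)) := by
  have := S.integral_comp_Y h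
    (fun y => f (fun n => (y n - S.meanY h n) / (Real.sqrt (S.varY h n) : ℂ)))
    (Continuous.stronglyMeasurable (f.continuous.comp (by fun_prop)))
  refine this.trans (integral_congr_ae (ae_of_all _ fun x => congrArg f (funext fun n => ?_)))
  simp only [meanY_eq, add_sub_cancel_left, varY_eq, chaosSum, stdCoef, Matrix.of_apply,
    Finset.sum_div]
  exact Finset.sum_congr rfl fun a _ => by ring

lemma aemeasurable_stdY : AEMeasurable (S.stdY h n) P := by
  have := (S.memLp_Y h n).aestronglyMeasurable.aemeasurable
  exact (this.sub_const _).div_const _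

lemma corrY_apply_self : S.corrY h n n = 1 := by
  have e (ω : Ω) : S.stdY h n ω * conj (S.stdY h n ω) =
      ((‖S.Y h n ω - S.meanY h n‖ ^ 2 : ℝ) : ℂ) / (S.varY h n : ℂ) := by
    have hs : ((Real.sqrt (S.varY h n) : ℂ)) * (Real.sqrt (S.varY h n) : ℂ) = S.varY h n := by
      rw [← Complex.ofReal_mul, Real.mul_self_sqrt]
      exact (S.varY_eq h n).symm ▸ (S.rowSq_pos h n).le
    rw [← Complex.normSq_eq_norm_sq, ← Complex.mul_conj, ← hs]
    simp only [stdY, map_div₀, Complex.conj_ofReal]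
    ring
  simp only [corrY, Matrix.of_apply, e]
  rw [integral_div, integral_complex_ofReal]
  refine div_self ?_
  have : S.varY h n ≠ 0 := (S.varY_eq h n).symm ▸ (S.rowSq_pos h n).ne'
  exact_mod_cast this

/-- The network that consists of all relays and the single receive component `n`. -/
def component : RelayNetwork 1 M P where
  Gbar _ m := S.Gbar n m
  Fbar := S.Fbar
  σG := S.σG
  σF := S.σF
  σV := S.σV
  σW := S.σW
  σG_pos := S.σG_pos
  σF_pos := S.σF_pos
  σW_pos := S.σW_pos
  G _ m := S.G n m
  F := S.F
  V := S.V
  W _ := S.W n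
  law_G _ m := S.law_G n m
  law_F := S.law_F
  law_V := S.law_V
  law_W _ := S.law_W n
  indep := by
    -- The sources of one component form a subfamily, selected by an injective relabelling.
    have h1 := S.indep.precomp (g := Sum.map (fun j : Fin 1 × Fin M => (n, j.2))
      (Sum.map id (Sum.map id fun _ : Fin 1 => n))) ?_
    · convert h1 using 2 with i
      rcases i with j | m | m | j <;> rfl
    · refine Function.Injective.sumMap ?_ (Function.injective_id.sumMap
        (Function.injective_id.sumMap fun _ _ _ => Subsingleton.elim _ _))
      rintro ⟨i, m⟩ ⟨i', m'⟩ h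
      simp only [Prod.mk.injEq, true_and] at h
      rw [Subsingleton.elim i i', h]

end RelayNetwork

/-! ### Moment generating function of a product of two real normals -/

section ProductMGF

/-- Tilting of the standard normal density by a quadratic exponential. -/
lemma gaussianPDFReal_mul_exp_quadratic {d : ℝ} (hd : d < 1) (c x : ℝ) :
    gaussianPDFReal 0 1 x * Real.exp (c * x + d * x ^ 2 / 2) =
      (Real.sqrt (1 - d))⁻¹ * Real.exp (c ^ 2 / (2 * (1 - d))) *
        gaussianPDFReal (c / (1 - d)) (Real.toNNReal (1 - d)⁻¹) x := by
  have h : 0 < 1 - d := by linarith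
  have h' : 0 < (1 - d)⁻¹ := inv_pos.2 h
  simp only [gaussianPDFReal, Real.coe_toNNReal _ h'.le, NNReal.coe_one]
  rw [Real.sqrt_mul (by positivity), Real.sqrt_mul (by positivity) (1 - d)⁻¹, Real.sqrt_inv,
    Real.sqrt_one]
  have hs := (Real.sqrt_pos.2 h).ne'
  have hp : Real.sqrt (2 * Real.pi) ≠ 0 := (Real.sqrt_pos.2 (by positivity)).ne'
  rw [mul_assoc, ← Real.exp_add, mul_inv, mul_inv, inv_inv]
  rw [show (Real.sqrt (1 - d))⁻¹ * Real.exp (c ^ 2 / (2 * (1 - d))) *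
      ((Real.sqrt (2 * Real.pi))⁻¹ * Real.sqrt (1 - d) *
        Real.exp (-(x - c / (1 - d)) ^ 2 / (2 * (1 - d)⁻¹))) =
      (Real.sqrt (2 * Real.pi))⁻¹ * (Real.exp (c ^ 2 / (2 * (1 - d))) *
        Real.exp (-(x - c / (1 - d)) ^ 2 / (2 * (1 - d)⁻¹))) by field_simp, ← Real.exp_add]
  rw [inv_one, mul_one]
  -- Completing the square: cx + dx²/2 - x²/2 = c²/(2(1 - d)) - (1 - d)(x - c/(1 - d))²/2.
  congr 2
  field_simp
  ring

lemma integrable_exp_quadratic_gaussianReal {d : ℝ} (hd : d < 1) (c : ℝ) :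
    Integrable (fun x => Real.exp (c * x + d * x ^ 2 / 2)) (gaussianReal 0 1) := by
  rw [gaussianReal_of_var_ne_zero _ one_ne_zero, gaussianPDF_def,
    integrable_withDensity_iff_integrable_smul' (by fun_prop) (by simp)]
  simp only [ENNReal.toReal_ofReal (gaussianPDFReal_nonneg _ _ _), smul_eq_mul,
    gaussianPDFReal_mul_exp_quadratic hd]
  exact (integrable_gaussianPDFReal _ _).const_mul _

lemma integral_exp_quadratic_gaussianReal {d : ℝ} (hd : d < 1) (c : ℝ) :
    ∫ x, Real.exp (c * x + d * x ^ 2 / 2) ∂(gaussianReal 0 1) =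
      (Real.sqrt (1 - d))⁻¹ * Real.exp (c ^ 2 / (2 * (1 - d))) := by
  rw [integral_gaussianReal_eq_integral_smul one_ne_zero]
  simp only [smul_eq_mul, gaussianPDFReal_mul_exp_quadratic hd]
  rw [integral_const_mul, integral_gaussianPDFReal_eq_one, mul_one]
  simpa using hd

/-- The moment generating function of a centred product of two independent unit-variance normals. -/
noncomputable def productMGF (a b θ : ℝ) : ℝ :=
  (Real.sqrt (1 - θ ^ 2))⁻¹ *
    Real.exp (θ ^ 2 * a ^ 2 / 2 + (θ * b + θ ^ 2 * a) ^ 2 / (2 * (1 - θ ^ 2)))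

lemma integral_exp_affine_gaussianReal (c r : ℝ) :
    ∫ y, Real.exp (c + r * y) ∂(gaussianReal 0 1) = Real.exp (c + r ^ 2 / 2) := by
  have h := integral_exp_quadratic_gaussianReal (d := 0) (by norm_num) r
  simp only [Real.exp_add]
  rw [integral_const_mul]
  simp at h
  rw [h]

lemma integrable_exp_affine_gaussianReal (c r : ℝ) :
    Integrable (fun y => Real.exp (c + r * y)) (gaussianReal 0 1) := by
  have h := integrable_exp_quadratic_gaussianReal (d := 0) (by norm_num) r
  simp only [Real.exp_add]
  simp at h
  exact h.const_mul _

lemma exp_productMGF_inner (a b θ x : ℝ) :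
    Real.exp (θ * b * x + (θ * (a + x)) ^ 2 / 2) =
      Real.exp (θ ^ 2 * a ^ 2 / 2) *
        Real.exp ((θ * b + θ ^ 2 * a) * x + θ ^ 2 * x ^ 2 / 2) := by
  rw [← Real.exp_add]
  congr 1
  ring

/-- For fixed x the exponent is affine in y. Integrating y out leaves a quadratic exponent in x with
leading coefficient θ²/2, integrable against the normal density since θ² < 1. -/
lemma integrable_exp_product_gaussianReal (a b : ℝ) {θ : ℝ} (hθ : θ ^ 2 < 1) :
    Integrable (fun p : ℝ × ℝ => Real.exp (θ * ((a + p.1) * (b + p.2) - a * b)))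
      ((gaussianReal 0 1).prod (gaussianReal 0 1)) := by
  have h (x y : ℝ) : Real.exp (θ * ((a + x) * (b + y) - a * b)) =
      Real.exp (θ * b * x + θ * (a + x) * y) := by
    congr 1
    ring
  rw [integrable_prod_iff (by fun_prop)]
  simp only [h, Real.norm_eq_abs, Real.abs_exp]
  refine ⟨ae_of_all _ fun x => integrable_exp_affine_gaussianReal _ _, ?_⟩
  simp only [integral_exp_affine_gaussianReal, exp_productMGF_inner]
  exact (integrable_exp_quadratic_gaussianReal hθ _).const_mul _

lemma integral_exp_product_gaussianReal (a b : ℝ) {θ : ℝ} (hθ : θ ^ 2 < 1) :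
    ∫ p : ℝ × ℝ, Real.exp (θ * ((a + p.1) * (b + p.2) - a * b))
      ∂((gaussianReal 0 1).prod (gaussianReal 0 1)) = productMGF a b θ := by
  have h (x y : ℝ) : Real.exp (θ * ((a + x) * (b + y) - a * b)) =
      Real.exp (θ * b * x + θ * (a + x) * y) := by
    congr 1
    ring
  rw [integral_prod _ (integrable_exp_product_gaussianReal a b hθ)]
  simp only [h, integral_exp_affine_gaussianReal, exp_productMGF_inner]
  rw [integral_const_mul, integral_exp_quadratic_gaussianReal hθ, productMGF, Real.exp_add]
  ring

/-- Over a common denominator the exponent is (θ²(a² + b²) + 2θ³ab) / (2(1 - θ²)). The cubic term is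
at most |θ| · θ²(a² + b²) up to a constant, so it vanishes. -/
lemma tendsto_productMGF {a b θ : ℕ → ℝ} {t : ℝ} (h0 : Tendsto θ atTop (𝓝 0))
    (h1 : Tendsto (fun k => θ k ^ 2 * (a k ^ 2 + b k ^ 2)) atTop (𝓝 (t ^ 2))) :
    Tendsto (fun k => productMGF (a k) (b k) (θ k)) atTop (𝓝 (Real.exp (t ^ 2 / 2))) := by
  have hs : Tendsto (fun k => 1 - θ k ^ 2) atTop (𝓝 1) := by
    simpa using (h0.pow 2).const_sub 1
  have hab : Tendsto (fun k => θ k ^ 3 * (a k * b k)) atTop (𝓝 0) := by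
    have hz : Tendsto (fun k => |θ k| * (θ k ^ 2 * (a k ^ 2 + b k ^ 2))) atTop (𝓝 0) := by
      simpa using h0.abs.mul h1
    refine squeeze_zero_norm (fun k => ?_) hz
    rw [Real.norm_eq_abs, show θ k ^ 3 * (a k * b k) = θ k * (θ k ^ 2 * (a k * b k)) by ring,
      abs_mul, abs_mul, abs_of_nonneg (sq_nonneg (θ k)), abs_mul]
    gcongr
    nlinarith [sq_abs (a k), sq_abs (b k), sq_nonneg (|a k| - |b k|), sq_nonneg (a k),
      sq_nonneg (b k)]
  have hc : Tendsto (fun k => (θ k ^ 2 * (a k ^ 2 + b k ^ 2) + 2 * (θ k ^ 3 * (a k * b k))) /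
      (2 * (1 - θ k ^ 2))) atTop (𝓝 (t ^ 2 / 2)) := by
    have := (h1.add (hab.const_mul 2)).div (hs.const_mul 2) (by norm_num)
    simp at this
    exact this
  have hev : ∀ᶠ k in atTop, 0 < 1 - θ k ^ 2 := hs.eventually (lt_mem_nhds one_pos)
  have he : Tendsto (fun k => θ k ^ 2 * a k ^ 2 / 2 +
      (θ k * b k + θ k ^ 2 * a k) ^ 2 / (2 * (1 - θ k ^ 2))) atTop (𝓝 (t ^ 2 / 2)) := by
    refine hc.congr' ?_
    filter_upwards [hev] with k hk
    field_simp
    ring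
  have := ((hs.sqrt).inv₀ (by simp)).mul (Real.continuous_exp.tendsto _ |>.comp he)
  simpa [productMGF] using this

variable {Ω : Type*} [MeasurableSpace Ω] {P : Measure Ω}

lemma hasLaw_standardize {X : Ω → ℝ} {m : ℝ} {σ : ℝ≥0} (hσ : 0 < σ)
    (hX : HasLaw X (gaussianReal m (σ ^ 2)) P) :
    HasLaw (fun ω => (X ω - m) / σ) (gaussianReal 0 1) P := by
  have := gaussianReal_div_const (gaussianReal_sub_const hX m) (σ : ℝ)
  convert this using 2
  · simp
  · ext
    have : (σ : ℝ) ≠ 0 := by exact_mod_cast hσ.ne'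
    simp [this]

lemma hasLaw_standardized_pair [IsProbabilityMeasure P] {X Y : Ω → ℝ} {mX mY : ℝ} {σX σY : ℝ≥0}
    (hσX : 0 < σX) (hσY : 0 < σY) (hX : HasLaw X (gaussianReal mX (σX ^ 2)) P)
    (hY : HasLaw Y (gaussianReal mY (σY ^ 2)) P) (hXY : IndepFun X Y P) :
    HasLaw (fun ω => ((X ω - mX) / σX, (Y ω - mY) / σY))
      ((gaussianReal 0 1).prod (gaussianReal 0 1)) P := by
  have h1 := hasLaw_standardize hσX hX
  have h2 := hasLaw_standardize hσY hY
  refine ⟨h1.aemeasurable.prodMk h2.aemeasurable, ?_⟩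
  have hi : IndepFun (fun ω => (X ω - mX) / σX) (fun ω => (Y ω - mY) / σY) P :=
    hXY.comp (φ := fun x => (x - mX) / σX) (ψ := fun y => (y - mY) / σY) (by fun_prop)
      (by fun_prop)
  rw [(indepFun_iff_map_prod_eq_prod_map_map h1.aemeasurable h2.aemeasurable).1 hi, h1.map_eq,
    h2.map_eq]

lemma integral_const_add_gaussianReal (a : ℝ) : ∫ x, (a + x) ∂(gaussianReal 0 1) = a := by
  have h : Integrable (fun x : ℝ => x) (gaussianReal 0 1) :=
    (memLp_id_gaussianReal 1).integrable le_rfl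
  rw [integral_add (integrable_const a) h]
  simp

lemma integrable_const_add_sq_gaussianReal (a : ℝ) :
    Integrable (fun x : ℝ => (a + x) ^ 2) (gaussianReal 0 1) :=
  ((memLp_const a).add (memLp_id_gaussianReal 2)).integrable_sq

lemma integral_const_add_sq_gaussianReal (a : ℝ) :
    ∫ x, (a + x) ^ 2 ∂(gaussianReal 0 1) = a ^ 2 + 1 := by
  have h := variance_eq_sub (X := fun x => a + x)
    ((memLp_const a).add (memLp_id_gaussianReal (μ := 0) (v := 1) 2))
  rw [variance_const_add (by fun_prop), variance_fun_id_gaussianReal,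
    integral_const_add_gaussianReal] at h
  simp only [Pi.pow_apply, NNReal.coe_one] at h
  linarith

lemma integral_product_gaussianReal (a b : ℝ) :
    ∫ p : ℝ × ℝ, (a + p.1) * (b + p.2) ∂((gaussianReal 0 1).prod (gaussianReal 0 1)) = a * b := by
  rw [integral_prod_mul (fun x => a + x) (fun y => b + y), integral_const_add_gaussianReal,
    integral_const_add_gaussianReal]

lemma variance_product_gaussianReal (a b : ℝ) :
    Var[fun p : ℝ × ℝ => (a + p.1) * (b + p.2); (gaussianReal 0 1).prod (gaussianReal 0 1)] =
      a ^ 2 + b ^ 2 + 1 := by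
  rw [variance_eq_sub, integral_product_gaussianReal]
  · simp only [Pi.pow_apply, mul_pow]
    rw [integral_prod_mul (fun x => (a + x) ^ 2) (fun y => (b + y) ^ 2),
      integral_const_add_sq_gaussianReal, integral_const_add_sq_gaussianReal]
    ring
  · rw [memLp_two_iff_integrable_sq (by fun_prop)]
    simp only [mul_pow]
    exact (integrable_const_add_sq_gaussianReal a).mul_prod (integrable_const_add_sq_gaussianReal b)

lemma stdProduct_eq [IsProbabilityMeasure P] {X Y : Ω → ℝ} {mX mY : ℝ} {σX σY : ℝ≥0}
    (hσX : 0 < σX) (hσY : 0 < σY) (hX : HasLaw X (gaussianReal mX (σX ^ 2)) P)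
    (hY : HasLaw Y (gaussianReal mY (σY ^ 2)) P) (hXY : IndepFun X Y P) (ω : Ω) :
    stdProduct P X Y σX σY ω =
      ((mX / σX + (X ω - mX) / σX) * (mY / σY + (Y ω - mY) / σY) - mX / σX * (mY / σY)) /
        Real.sqrt ((mX / σX) ^ 2 + (mY / σY) ^ 2 + 1) := by
  have h := hasLaw_standardized_pair hσX hσY hX hY hXY
  have e (ω : Ω) : X ω * Y ω / (σX * σY) =
      (mX / σX + (X ω - mX) / σX) * (mY / σY + (Y ω - mY) / σY) := by
    ring
  have h1 := h.integral_comp (f := fun p : ℝ × ℝ => (mX / σX + p.1) * (mY / σY + p.2))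
    (by fun_prop)
  have h2 := variance_map (X := fun p : ℝ × ℝ => (mX / σX + p.1) * (mY / σY + p.2))
    (by fun_prop) h.aemeasurable
  rw [integral_product_gaussianReal] at h1
  rw [h.map_eq, variance_product_gaussianReal] at h2
  simp only [Function.comp_def] at h1 h2
  simp only [stdProduct, e, h1, ← h2]

/-- Integrability and value of the moment generating function of a standardized product. -/
lemma mgf_stdProduct [IsProbabilityMeasure P] {X Y : Ω → ℝ} {mX mY : ℝ} {σX σY : ℝ≥0}
    (hσX : 0 < σX) (hσY : 0 < σY) (hX : HasLaw X (gaussianReal mX (σX ^ 2)) P)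
    (hY : HasLaw Y (gaussianReal mY (σY ^ 2)) P) (hXY : IndepFun X Y P) {t θ : ℝ}
    (hθ : θ = t / Real.sqrt ((mX / σX) ^ 2 + (mY / σY) ^ 2 + 1)) (h1 : θ ^ 2 < 1) :
    Integrable (fun ω => Real.exp (t * stdProduct P X Y σX σY ω)) P ∧
      mgf (stdProduct P X Y σX σY) P t = productMGF (mX / σX) (mY / σY) θ := by
  have h := hasLaw_standardized_pair hσX hσY hX hY hXY
  let φ (p : ℝ × ℝ) : ℝ :=
    Real.exp (θ * ((mX / σX + p.1) * (mY / σY + p.2) - mX / σX * (mY / σY)))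
  have hφ : Measurable φ := by fun_prop
  have e : (fun ω => Real.exp (t * stdProduct P X Y σX σY ω)) =
      φ ∘ fun ω => ((X ω - mX) / σX, (Y ω - mY) / σY) := by
    funext ω
    rw [stdProduct_eq hσX hσY hX hY hXY, Function.comp_apply]
    simp only [φ, hθ]
    congr 1
    ring
  constructor
  · rw [e, ← integrable_map_measure hφ.aestronglyMeasurable h.aemeasurable, h.map_eq]
    exact integrable_exp_product_gaussianReal _ _ h1
  · rw [mgf, e, h.integral_comp hφ.aestronglyMeasurable]
    exact integral_exp_product_gaussianReal _ _ h1

lemma tendsto_productMGF_of_tendsto {a b : ℕ → ℝ} (t : ℝ)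
    (h : Tendsto (fun k => |a k|) atTop atTop ∨ Tendsto (fun k => |b k|) atTop atTop) :
    Tendsto (fun k => t / Real.sqrt (a k ^ 2 + b k ^ 2 + 1)) atTop (𝓝 0) ∧
    Tendsto (fun k => productMGF (a k) (b k) (t / Real.sqrt (a k ^ 2 + b k ^ 2 + 1))) atTop
      (𝓝 (Real.exp (t ^ 2 / 2))) := by
  have hs : Tendsto (fun k => Real.sqrt (a k ^ 2 + b k ^ 2 + 1)) atTop atTop := by
    rcases h with h | h
    · refine tendsto_atTop_mono (fun k => Real.le_sqrt_of_sq_le ?_) h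
      rw [sq_abs]
      nlinarith [sq_nonneg (b k)]
    · refine tendsto_atTop_mono (fun k => Real.le_sqrt_of_sq_le ?_) h
      rw [sq_abs]
      nlinarith [sq_nonneg (a k)]
  have h0 : Tendsto (fun k => t / Real.sqrt (a k ^ 2 + b k ^ 2 + 1)) atTop (𝓝 0) :=
    hs.const_div_atTop t
  refine ⟨h0, tendsto_productMGF h0 ?_⟩
  -- With θ = t / √(a² + b² + 1), θ²(a² + b²) = t² - θ².
  have h1 : Tendsto (fun k => t ^ 2 - (t / Real.sqrt (a k ^ 2 + b k ^ 2 + 1)) ^ 2) atTop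
      (𝓝 (t ^ 2)) := by
    simpa using (h0.pow 2).const_sub (t ^ 2)
  refine h1.congr fun k => ?_
  have hp : 0 < a k ^ 2 + b k ^ 2 + 1 := by positivity
  rw [div_pow, Real.sq_sqrt hp.le]
  field_simp
  ring

end ProductMGF

/-! ### Asymptotic normality under diverging line of sight -/

section LineOfSight

variable {N M : ℕ} {Ω : ℕ → Type*} [∀ k, MeasurableSpace (Ω k)] {P : ∀ k, Measure (Ω k)}
  {S : ∀ k, RelayNetwork N M (P k)} {h : Hypothesis} {n : Fin N}

/-- Reduces the three alternatives to one variance bound; the third follows from the second because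
ρF is at most a constant times ρR. -/
lemma LineOfSightDiverges.exists_ratio (hS : LineOfSightDiverges S h n) :
    ∃ r : ℕ → ℝ, Tendsto r atTop atTop ∧
      ∀ k, r k ^ 2 * (((S k).σG : ℝ) ^ 2 * (S k).σR h ^ 2) ≤ (S k).rowSq h n := by
  rcases hS with ⟨m, hm⟩ | ⟨m, hm⟩ | ⟨rfl, ⟨m, hm⟩, c, hc⟩
  · exact ⟨_, hm, fun k => (S k).ρG_sq_mul_le_rowSq h n m⟩
  · exact ⟨_, hm, fun k => (S k).ρR_sq_mul_le_rowSq h n m⟩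
  · refine ⟨_, ?_, fun k => (S k).ρR_sq_mul_le_rowSq .H1 n m⟩
    have hC : 0 < Real.sqrt (1 + (c : ℝ) ^ 2) := Real.sqrt_pos.2 (by positivity)
    exact (tendsto_const_mul_atTop_of_pos hC).1
      (tendsto_atTop_mono (fun k => (S k).ρF_le_mul_ρR (hc k) m) hm)

lemma LineOfSightDiverges.tendsto_stdCoef_inr (hS : LineOfSightDiverges S h n) (b) :
    Tendsto (fun k => (S k).stdCoef h n (.inr b)) atTop (𝓝 0) := by
  obtain ⟨r, hr, hle⟩ := hS.exists_ratio
  refine squeeze_zero_norm' ?_ hr.inv_tendsto_atTop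
  filter_upwards [hr.eventually_gt_atTop 0] with k hk
  exact (S k).norm_stdCoef_inr_le h n hk (hle k) b

lemma LineOfSightDiverges.component (hS : LineOfSightDiverges S h n) :
    LineOfSightDiverges (fun k => (S k).component n) h 0 := by
  cases h <;> exact hS

variable [∀ k, IsProbabilityMeasure (P k)]

/-- Under diverging lines of sight the standardized received vector is asymptotically complex
normal. -/
theorem exists_isComplexNormalVector_tendsto_integral_stdY
    (hS : ∀ n : Fin N, LineOfSightDiverges S h n) :
    ∃ ν : ℕ → Measure (Fin N → ℂ),
      (∀ k, IsComplexNormalVector (ν k) 0 ((S k).corrY h)) ∧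
      ∀ f : (Fin N → ℂ) →ᵇ ℝ,
        Tendsto (fun k => ∫ ω, f (fun n => (S k).stdY h n ω) ∂(P k) - ∫ y, f y ∂(ν k))
          atTop (𝓝 0) := by
  refine ⟨fun k => (stdComplexNormalPi _).map ((S k).stdCoef h).mulVec, fun k => ?_, fun f => ?_⟩
  · rw [RelayNetwork.corrY_eq]
    exact isComplexNormalVector_map_mulVec _
  · simp only [RelayNetwork.integral_stdY]
    exact tendsto_integral_chaosSum_sub (fun k => (S k).stdCoef h)
      (fun k n a => (S k).norm_stdCoef_le_one h n a) (fun n b => (hS n).tendsto_stdCoef_inr b) f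

/-- Under a diverging line of sight a standardized received component is asymptotically complex
normal. -/
theorem LineOfSightDiverges.tendstoInDistribution_stdY (hS : LineOfSightDiverges S h n) :
    TendstoInDistribution (fun k => (S k).stdY h n) atTop (id : ℂ → ℂ) P (complexNormal 0 1) := by
  have hY (k : ℕ) : (S k).stdY h n = ((S k).component n).stdY h 0 := by cases h <;> rfl
  obtain ⟨ν, hν, hf⟩ := exists_isComplexNormalVector_tendsto_integral_stdY
    (S := fun k => (S k).component n) (h := h) (fun i => by
      rw [Subsingleton.elim i 0]
      exact hS.component)
  -- For a single component the correlation matrix is 1, so the approximating law does not depend on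
  -- `k` and is a genuine limit.
  have hν' (k : ℕ) : ν k = stdComplexNormalPi (Fin 1) := by
    refine IsComplexNormalVector.eq_of_one ?_
    have h1 : ((S k).component n).corrY h = 1 := by
      ext i j
      rw [Subsingleton.elim i 0, Subsingleton.elim j 0, RelayNetwork.corrY_apply_self]
      rfl
    exact h1 ▸ hν k
  refine ⟨fun k => (S k).aemeasurable_stdY h n, aemeasurable_id, ?_⟩
  refine ProbabilityMeasure.tendsto_iff_forall_integral_tendsto.2 fun g => ?_
  have := hf (g.compContinuous ⟨fun y : Fin 1 → ℂ => y 0, continuous_apply 0⟩)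
  simp only [hν', BoundedContinuousFunction.compContinuous_apply, ContinuousMap.coe_mk] at this
  have e : ∫ y : Fin 1 → ℂ, g (y 0) ∂(stdComplexNormalPi (Fin 1)) =
      ∫ z, g z ∂(complexNormal 0 1) := by
    conv_rhs => rw [← (measurePreserving_eval (fun _ : Fin 1 => complexNormal 0 1) 0).map_eq]
    rw [integral_map (measurable_pi_apply 0).aemeasurable
      g.continuous.measurable.aestronglyMeasurable]
  rw [e] at this
  have h2 := this.add_const (∫ z, g z ∂(complexNormal 0 1))
  simp only [sub_add_cancel, zero_add] at h2
  simp only [ProbabilityMeasure.coe_mk, Measure.map_id]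
  refine h2.congr fun k => ?_
  rw [integral_map ((S k).aemeasurable_stdY h n) g.continuous.measurable.aestronglyMeasurable, hY]

end LineOfSight

theorem mainTheorem7 {N M : ℕ} :
    -- each received component is asymptotically complex normal
    (∀ {Ω : ℕ → Type*} [∀ k, MeasurableSpace (Ω k)] (P : ∀ k, Measure (Ω k))
      [∀ k, IsProbabilityMeasure (P k)] (S : ∀ k, RelayNetwork N M (P k)) (h : Hypothesis),
      (∀ n : Fin N, (∀ k, MemLp ((S k).Y h n) 2 (P k) ∧ 0 < (S k).varY h n) ∧
        (LineOfSightDiverges S h n →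
          TendstoInDistribution (fun k => (S k).stdY h n) atTop (id : ℂ → ℂ) P
            (complexNormal 0 1))) ∧
      -- the received vector is asymptotically multivariate complex normal
      ((∀ n : Fin N, LineOfSightDiverges S h n) →
        ∃ ν : ℕ → Measure (Fin N → ℂ),
          (∀ k, IsComplexNormalVector (ν k) 0 ((S k).corrY h)) ∧
          ∀ f : (Fin N → ℂ) →ᵇ ℝ,
            Tendsto (fun k => ∫ ω, f (fun n => (S k).stdY h n ω) ∂(P k) - ∫ y, f y ∂(ν k))
              atTop (𝓝 0))) ∧
    -- the moment generating function of a standardized product of two independent real normals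
    (∀ {Ω : ℕ → Type*} [∀ k, MeasurableSpace (Ω k)] (P : ∀ k, Measure (Ω k))
      [∀ k, IsProbabilityMeasure (P k)] (X Y : ∀ k, Ω k → ℝ) (Xbar Ybar : ℕ → ℝ)
      (σX σY : ℕ → ℝ≥0), (∀ k, 0 < σX k) → (∀ k, 0 < σY k) →
      (∀ k, HasLaw (X k) (gaussianReal (Xbar k) (σX k ^ 2)) (P k)) →
      (∀ k, HasLaw (Y k) (gaussianReal (Ybar k) (σY k ^ 2)) (P k)) →
      (∀ k, IndepFun (X k) (Y k) (P k)) →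
      (Tendsto (fun k => |Xbar k| / σX k) atTop atTop ∨
        Tendsto (fun k => |Ybar k| / σY k) atTop atTop) →
      ∀ t : ℝ,
        (∀ᶠ k in atTop, Integrable
          (fun ω => Real.exp (t * stdProduct (P k) (X k) (Y k) (σX k) (σY k) ω)) (P k)) ∧
        Tendsto (fun k => mgf (stdProduct (P k) (X k) (Y k) (σX k) (σY k)) (P k) t) atTop
          (𝓝 (Real.exp (t ^ 2 / 2)))) := by

  refine ⟨fun P _ S h => ⟨fun n => ⟨fun k => ⟨(S k).memLp_Y h n, ?_⟩,
    fun hS => hS.tendstoInDistribution_stdY⟩,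
    fun hS => exists_isComplexNormalVector_tendsto_integral_stdY hS⟩, ?_⟩
  · rw [RelayNetwork.varY_eq]
    exact (S k).rowSq_pos h n
  · intro Ω _ P _ X Y Xbar Ybar σX σY hσX hσY hX hY hXY hlos t
    have hlos' : Tendsto (fun k => |Xbar k / σX k|) atTop atTop ∨
        Tendsto (fun k => |Ybar k / σY k|) atTop atTop := by
      simpa only [abs_div, NNReal.abs_eq] using hlos
    obtain ⟨h0, h1⟩ := tendsto_productMGF_of_tendsto t hlos'
    -- θ² < 1 holds only eventually, hence finiteness of the moment generating function is claimed
    -- only eventually.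
    have hev := (h0.pow 2).eventually (gt_mem_nhds (show (0 : ℝ) ^ 2 < 1 by norm_num))
    have key := hev.mono fun k hk =>
      mgf_stdProduct (hσX k) (hσY k) (hX k) (hY k) (hXY k) (t := t) rfl hk
    exact ⟨key.mono fun k hk => hk.1, h1.congr' (key.mono fun k hk => hk.2.symm)⟩
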